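/- Let $k \ge 0$ and $n$ be integers with $n \ge 2k+1$, $n \ge 4$ and $(n,k) \notin \{(4,1),(5,2)\}$ (equivalently, $n \ge 2k+1$ and $n-k \ge 4$). Let $S_n$ be the symmetric group on $\{1,\dots,n\}$, let $D_n^k \subseteq S_n$ be the set of permutations with exactly $k$ fixed points, and let $\Gamma_n^k$ be the Cayley graph of $S_n$ with respect to $D_n^k$: its vertices are the elements of $S_n$, and $u, v \in S_n$ are adjacent if and only if $v = su$ for some $s \in D_n^k$. Then $\Gamma_n^k$ is edge pancyclic: every edge of $\Gamma_n^k$ lies on a cycle of length $\ell$ for each integer $\ell$ with $3 \le \ell \le n!$. -/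

import Mathlib

/-- The Cayley graph of a group `G` with respect to a connection set `S`: distinct vertices `u`, `v`
are joined when `v = s * u` for some `s ∈ S` (or the same with `u`, `v` exchanged; this adds nothing
when `S` is inverse-closed, and `u ≠ v` is automatic when `1 ∉ S`). Connection elements multiply
from the left, whereas in Mathlib's `SimpleGraph.mulCayley` they multiply from the right. -/
def leftCayleyGraph {G : Type*} [Group G] (S : Set G) : SimpleGraph G :=
  SimpleGraph.fromRel fun u v => ∃ s ∈ S, v = s * u

/-- The permutations of an `n`-element set with exactly `k` fixed points. -/
def permsWithFixed (n k : ℕ) : Set (Equiv.Perm (Fin n)) :=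
  {σ | (Finset.univ.filter fun i => σ i = i).card = k}

/-- The Cayley graph of the symmetric group on `n` points with respect to the permutations with
exactly `k` fixed points. -/
def fixedPointGraph (n k : ℕ) : SimpleGraph (Equiv.Perm (Fin n)) :=
  leftCayleyGraph (permsWithFixed n k)

/-- A graph of order at least `3` is edge pancyclic if every edge lies on a cycle of each length
from `3` to the order of the graph. -/
def SimpleGraph.IsEdgePancyclic {V : Type*} [Fintype V] (G : SimpleGraph V) : Prop :=
  3 ≤ Fintype.card V ∧
    ∀ e ∈ G.edgeSet, ∀ l : ℕ, 3 ≤ l → l ≤ Fintype.card V →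
      ∃ (v : V) (c : G.Walk v v), c.IsCycle ∧ c.length = l ∧ e ∈ c.edges

/-- For fewer than `n` fixed points, adjacency means agreeing at exactly `k` positions. -/
theorem fixedPointGraph_adj {n k : ℕ} (hk : k < n) (u v : Equiv.Perm (Fin n)) :
    (fixedPointGraph n k).Adj u v ↔ (Finset.univ.filter fun i => u i = v i).card = k := by
  have key : ∀ u v : Equiv.Perm (Fin n), (∃ s ∈ permsWithFixed n k, v = s * u) ↔
      (Finset.univ.filter fun i => u i = v i).card = k := by
    intro u v
    have h : (Finset.univ.filter fun i => (v * u⁻¹) i = i).card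
        = (Finset.univ.filter fun i => u i = v i).card := by
      refine Finset.card_bij (fun i _ => u⁻¹ i) ?_ ?_ ?_
      · intro i hi
        rw [Finset.mem_filter] at hi ⊢
        refine ⟨Finset.mem_univ _, ?_⟩
        simpa using hi.2.symm
      · intro i _ j _ hij
        exact u⁻¹.injective hij
      · intro j hj
        refine ⟨u j, ?_, by simp⟩
        rw [Finset.mem_filter] at hj ⊢
        refine ⟨Finset.mem_univ _, ?_⟩
        simpa using hj.2.symm
    constructor
    · rintro ⟨s, hs, rfl⟩
      rw [← h]
      simpa [permsWithFixed] using hs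
    · intro hc
      exact ⟨v * u⁻¹, h.trans hc, by simp⟩
  have key' := key v u
  simp only [eq_comm (a := v _)] at key'
  unfold fixedPointGraph leftCayleyGraph
  rw [SimpleGraph.fromRel_adj, key, key', or_self]
  refine and_iff_right_of_imp ?_
  rintro hc rfl
  simp at hc
  omega

/-! An edge `uv` lies on a cycle of length `l` once its ends are joined by a path on `l` vertices.
Such paths are built by splitting the graph into blocks and absorbing the blocks one at a time: if
`f` maps a block into the next one, preserving edges and sending each vertex to a neighbour, an edge
`ac` of a path can be replaced by a detour `a, f a, ..., f c, c` (`IsPanIn.glue`, `IsPanIn.chain`).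

The induction on `k` lowers `n` and `k` together, keeping `n - k ≥ 4`. For `k + 1`, the ends agree
at some `p`, and the blocks are the fibres of `σ ↦ σ p`, copies of the graph for `n - 1` and `k`.

For `k = 0`, the domain is made an abelian group and the blocks are the classes of bijections under
translation of the argument, cliques of size `n`. Not all pairs of blocks need be linked, but a
block is linked to at least one of any two that differ by a transposition
(`hasAvoidingTranslate_or_swap`). Pairing the blocks by a transposition therefore lets a chain cover
them greedily. -/

namespace SimpleGraph

/-! ### Paths of prescribed length and gluing of blocks -/

variable {V W ι : Type*}

/-- There is a path from `a` to `b` on exactly `l` vertices, all of them in `T`. -/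
def HasPathIn (G : SimpleGraph V) (T : Set V) (a b : V) (l : ℕ) : Prop :=
  ∃ p : G.Walk a b, p.IsPath ∧ p.length + 1 = l ∧ ∀ v ∈ p.support, v ∈ T

/-- The ends of every edge inside `B` are joined by paths in `T` on `l` vertices, for each `l` from
`2` to `M`. -/
def IsPanIn (G : SimpleGraph V) (B T : Set V) (M : ℕ) : Prop :=
  ∀ a ∈ B, ∀ b ∈ B, G.Adj a b → ∀ l, 2 ≤ l → l ≤ M → G.HasPathIn T a b l

/-- There is a map from `B` into `B'` that preserves adjacency inside `B` and moves every vertex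
of `B` to a neighbour. -/
def IsLinked (G : SimpleGraph V) (B B' : Set V) : Prop :=
  ∃ f : V → V, (∀ v ∈ B, f v ∈ B' ∧ G.Adj v (f v)) ∧
    ∀ a ∈ B, ∀ b ∈ B, G.Adj a b → G.Adj (f a) (f b)

variable {G : SimpleGraph V}

theorem HasPathIn.mono {T T' : Set V} {a b : V} {l : ℕ} (h : G.HasPathIn T a b l) (hT : T ⊆ T') :
    G.HasPathIn T' a b l := by
  obtain ⟨p, hp, hl, hs⟩ := h
  exact ⟨p, hp, hl, fun v hv => hT (hs v hv)⟩

theorem HasPathIn.single (a : V) : G.HasPathIn {a} a a 1 :=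
  ⟨.nil, .nil, rfl, by simp⟩

theorem HasPathIn.symm {T : Set V} {a b : V} {l : ℕ} (h : G.HasPathIn T a b l) :
    G.HasPathIn T b a l := by
  obtain ⟨p, hp, hl, hs⟩ := h
  exact ⟨p.reverse, hp.reverse, by simpa using hl, by simpa using hs⟩

theorem HasPathIn.append {T T' : Set V} {a b c d : V} {l l' : ℕ} (h : G.HasPathIn T a b l)
    (hbc : G.Adj b c) (h' : G.HasPathIn T' c d l') (hT : Disjoint T T') :
    G.HasPathIn (T ∪ T') a d (l + l') := by
  obtain ⟨p, hp, rfl, hs⟩ := h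
  obtain ⟨q, hq, rfl, hs'⟩ := h'
  refine ⟨p.append (.cons hbc q), ?_, by simp; omega, ?_⟩
  · rw [Walk.isPath_def, Walk.support_append, Walk.support_cons, List.tail_cons,
      List.nodup_append]
    refine ⟨hp.support_nodup, hq.support_nodup, ?_⟩
    rintro x hx y hy rfl
    exact Set.disjoint_left.1 hT (hs x hx) (hs' x hy)
  · intro v hv
    rw [Walk.support_append, Walk.support_cons, List.tail_cons, List.mem_append] at hv
    exact hv.imp (hs v) (hs' v)

theorem HasPathIn.of_adj {T : Set V} {a b : V} (hab : G.Adj a b) (ha : a ∈ T) (hb : b ∈ T) :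
    G.HasPathIn T a b 2 :=
  ((HasPathIn.single a).append hab (HasPathIn.single b)
    (Set.disjoint_singleton.2 hab.ne)).mono (by simp [Set.insert_subset_iff, ha, hb])

/-- A path on at least two vertices has a first edge. -/
theorem HasPathIn.exists_first {T : Set V} {a b : V} {l : ℕ} (h : G.HasPathIn T a b (l + 2)) :
    a ∈ T ∧ ∃ c ∈ T, G.Adj a c ∧ G.HasPathIn (T \ {a}) c b (l + 1) := by
  obtain ⟨p, hp, hl, hs⟩ := h
  cases p with
  | nil => simp at hl
  | cons hac q =>
    rw [Walk.cons_isPath_iff] at hp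
    simp only [Walk.support_cons, List.mem_cons, forall_eq_or_imp] at hs
    refine ⟨hs.1, _, hs.2 _ q.start_mem_support, hac, q, hp.1, by simpa using hl, ?_⟩
    intro v hv
    exact ⟨hs.2 v hv, fun h => hp.2 (h ▸ hv)⟩

theorem HasPathIn.map {G' : SimpleGraph W} {T : Set V} {T' : Set W} {a b : V} {l : ℕ}
    (h : G.HasPathIn T a b l) (f : G →g G') (hf : Function.Injective f)
    (hT : ∀ v ∈ T, f v ∈ T') : G'.HasPathIn T' (f a) (f b) l := by
  obtain ⟨p, hp, hl, hs⟩ := h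
  refine ⟨p.map f, Walk.IsPath.map hf hp, by simpa using hl, ?_⟩
  intro v hv
  rw [Walk.support_map, List.mem_map] at hv
  obtain ⟨w, hw, rfl⟩ := hv
  exact hT w (hs w hw)

theorem isPanIn_of_isClique {B : Set V} (hfin : B.Finite) (hB : G.IsClique B) :
    G.IsPanIn B B B.ncard := by
  intro a ha b hb hab l hl hl'
  induction l, hl using Nat.le_induction generalizing a B with
  | base => exact .of_adj hab ha hb
  | succ l hl ih =>
    obtain ⟨c, hc, hc'⟩ := Set.exists_mem_notMem_of_ncard_lt_ncard (s := {a, b}) (t := B)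
      (by rw [Set.ncard_pair hab.ne]; omega)
    simp only [Set.mem_insert_iff, Set.mem_singleton_iff, not_or] at hc'
    have h := ih (B := B \ {a}) hfin.sdiff (hB.subset Set.sdiff_subset) c ⟨hc, hc'.1⟩
      ⟨hb, hab.ne'⟩ (hB hc hb hc'.2) (by rw [Set.ncard_sdiff_singleton_of_mem ha]; omega)
    have := (HasPathIn.single a).append (hB ha hc (Ne.symm hc'.1)) h Set.disjoint_sdiff_right
    rw [add_comm l 1]
    exact this.mono (by simp [ha])

/-- The first edge of a path in `B` is replaced by a detour through `T`. Only edges inside `B'` need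
paths in `T`, so the result can serve as the `T` of another gluing. -/
theorem IsPanIn.glue {B B' T : Set V} {N M : ℕ} (hB : G.IsPanIn B B N) (hT : G.IsPanIn B' T M)
    (hd : Disjoint B T) (hf : G.IsLinked B B') (hN : 3 ≤ N) (hM : 2 ≤ M) :
    G.IsPanIn B (B ∪ T) (N + M) := by
  obtain ⟨f, hf, hf'⟩ := hf
  intro a ha b hb hab l hl hl'
  by_cases hlN : l ≤ N
  · exact (hB a ha b hb hab l hl hlN).mono Set.subset_union_left
  -- The path in `B` has `m + 2` vertices and the detour adds `m'`. Since `l > N ≥ 3`, the choice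
  -- `m' = l - 2` is at least `2`.
  obtain ⟨m, m', rfl, hm, hm', hmM⟩ : ∃ m m', l = 1 + m' + (m + 1) ∧ m + 2 ≤ N ∧ 2 ≤ m' ∧ m' ≤ M := by
    by_cases h : l - 2 ≤ M
    · exact ⟨0, l - 2, by omega, by omega, by omega, h⟩
    · exact ⟨l - 2 - M, M, by omega, by omega, by omega, le_rfl⟩
  obtain ⟨-, c, hc, hac, hcb⟩ := (hB a ha b hb hab (m + 2) (by omega) hm).exists_first
  have h₁ := hT _ (hf a ha).1 _ (hf c hc).1 (hf' a ha c hc hac) m' hm' hmM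
  have h₂ := (HasPathIn.single a).append (hf a ha).2 h₁
    (hd.mono_left (Set.singleton_subset_iff.2 ha))
  refine (h₂.append (hf c hc).2.symm hcb ?_).mono ?_
  · rw [Set.disjoint_union_left]
    exact ⟨Set.disjoint_sdiff_right, hd.symm.mono_right Set.sdiff_subset⟩
  · rintro x ((rfl | hx) | hx)
    · exact .inl ha
    · exact .inr hx
    · exact .inl hx.1

theorem IsPanIn.chain {B : ι → Set V} {N : ℕ} (hN : 3 ≤ N) (i : ι) (L : List ι)
    (hB : ∀ j ∈ i :: L, G.IsPanIn (B j) (B j) N)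
    (hd : ∀ j ∈ i :: L, ∀ j' ∈ i :: L, j ≠ j' → Disjoint (B j) (B j'))
    (hL : (i :: L).Nodup) (hc : (i :: L).IsChain fun j j' => G.IsLinked (B j) (B j')) :
    G.IsPanIn (B i) {v | ∃ j ∈ i :: L, v ∈ B j} (N * (i :: L).length) := by
  induction L generalizing i with
  | nil =>
    have := hB i (by simp)
    simpa using this
  | cons j L ih =>
    rw [List.isChain_cons_cons] at hc
    have h := ih j (fun x hx => hB x (List.mem_cons_of_mem _ hx))
      (fun x hx y hy => hd x (List.mem_cons_of_mem _ hx) y (List.mem_cons_of_mem _ hy))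
      hL.of_cons hc.2
    have hg := (hB i (by simp)).glue h ?_ hc.1 hN ?_
    · have e : {v | ∃ j' ∈ i :: j :: L, v ∈ B j'} = B i ∪ {v | ∃ j' ∈ j :: L, v ∈ B j'} := by
        ext v
        simp
      rw [e, List.length_cons, mul_add, mul_one, add_comm]
      exact hg
    · rw [Set.disjoint_left]
      rintro v hv ⟨x, hx, hvx⟩
      refine Set.disjoint_left.1 (hd i (by simp) x (List.mem_cons_of_mem _ hx) ?_) hv hvx
      rintro rfl
      exact (List.nodup_cons.1 hL).1 hx
    · rw [List.length_cons]
      nlinarith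

/-- A path on at least three vertices between adjacent vertices closes up to a cycle. -/
theorem HasPathIn.exists_isCycle {T : Set V} {a b : V} {l : ℕ} (h : G.HasPathIn T a b l)
    (hab : G.Adj a b) (hl : 3 ≤ l) :
    ∃ c : G.Walk b b, c.IsCycle ∧ c.length = l ∧ s(a, b) ∈ c.edges := by
  obtain ⟨p, hp, rfl, -⟩ := h
  refine ⟨.cons hab.symm p, ?_, by simp, by simp [Sym2.eq_swap]⟩
  rw [Walk.cons_isCycle_iff]
  refine ⟨hp, fun he => ?_⟩
  cases p with
  | nil => simp at hl
  | cons hac q =>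
    rw [Walk.cons_isPath_iff] at hp
    rw [Walk.edges_cons, List.mem_cons] at he
    rcases he with he | he
    · rw [Sym2.eq_iff] at he
      rcases he with ⟨h1, h2⟩ | ⟨rfl, -⟩
      · exact hab.ne h1.symm
      · have := Walk.length_eq_zero_iff.2 (Walk.isPath_iff_nil.1 hp.1)
        rw [Walk.length_cons] at hl
        omega
    · exact hp.2 (q.snd_mem_support_of_mem_edges he)

end SimpleGraph

/-! ### Agreement graphs on bijections -/

/-- The graph on the bijections `α ≃ β` in which two of them are joined when they agree at exactly
`k` points. -/
def agreeGraph (α β : Type*) (k : ℕ) : SimpleGraph (α ≃ β) where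
  Adj u v := u ≠ v ∧ {x | u x = v x}.ncard = k
  symm := ⟨fun u v h => ⟨h.1.symm, by simpa only [eq_comm] using h.2⟩⟩
  loopless := ⟨fun _ h => h.1 rfl⟩

theorem agreeGraph_adj {α β : Type*} {k : ℕ} {u v : α ≃ β} :
    (agreeGraph α β k).Adj u v ↔ u ≠ v ∧ {x | u x = v x}.ncard = k := Iff.rfl

theorem agreeGraph_zero_adj {α β : Type*} [Finite α] [Nonempty α] {u v : α ≃ β} :
    (agreeGraph α β 0).Adj u v ↔ ∀ x, u x ≠ v x := by
  rw [agreeGraph_adj, Set.ncard_eq_zero, Set.eq_empty_iff_forall_notMem]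
  refine ⟨fun h => h.2, fun h => ⟨?_, h⟩⟩
  rintro rfl
  exact h (Classical.arbitrary α) rfl

/-- A permutation of a finite type with exactly `k` fixed points and a prescribed value `j` at a
point `i ≠ j`. -/
theorem exists_perm_ncard_fixed {β : Type*} [Finite β] {i j : β} (hij : i ≠ j) {k : ℕ}
    (hk : k + 2 ≤ Nat.card β) :
    ∃ x : Equiv.Perm β, x i = j ∧ {y | x y = y}.ncard = k := by
  classical
  have := Fintype.ofFinite β
  rw [Nat.card_eq_fintype_card] at hk
  obtain ⟨s, hs, hcard⟩ := Finset.exists_superset_card_eq (s := {i, j})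
    (n := Fintype.card β - k) (by rw [Finset.card_pair hij]; omega) (by omega)
  have hi : i ∈ s := hs (by simp)
  have hj : j ∈ s := hs (by simp)
  obtain ⟨f, hf, hfs⟩ := s.exists_cycleOn
  have hnt : (s : Set β).Nontrivial := ⟨i, hi, j, hj, hij⟩
  have hfix : ∀ y, f y = y ↔ y ∈ sᶜ := fun y => by
    rw [Finset.mem_compl]
    exact ⟨fun h hy => hf.apply_ne hnt hy h,
      fun h => Equiv.Perm.notMem_support.1 fun h' => h (hfs h')⟩
  have hfi : i ≠ f i := fun h => (hf.apply_ne hnt hi) h.symm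
  -- Conjugating the cycle `f` by the transposition of `f i` and `j` makes it send `i` to `j` and
  -- keeps the number of fixed points.
  refine ⟨(Equiv.swap (f i) j).trans (f.trans (Equiv.swap (f i) j)), ?_, ?_⟩
  · simp [Equiv.swap_apply_of_ne_of_ne hfi hij]
  · have : {y | (Equiv.swap (f i) j).trans (f.trans (Equiv.swap (f i) j)) y = y} =
        Equiv.swap (f i) j ⁻¹' (sᶜ : Finset β) := by
      ext y
      rw [Set.mem_preimage, Finset.mem_coe, ← hfix, Set.mem_ofPred_eq, Equiv.trans_apply,
        Equiv.trans_apply, ← Equiv.eq_symm_apply, Equiv.symm_swap]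
    rw [this, ← Equiv.image_symm_eq_preimage, Set.ncard_image_of_injective _ (Equiv.injective _),
      Set.ncard_coe_finset, Finset.card_compl]
    omega

/-! ### Fixing one value: the induction step -/

section Extend

variable {α β : Type*} (p : α) (j : β)

open Classical in
/-- The bijection that extends `e` by `p ↦ j`. -/
noncomputable def extendAt (e : {x // x ≠ p} ≃ {y // y ≠ j}) : α ≃ β where
  toFun x := if h : x = p then j else e ⟨x, h⟩
  invFun y := if h : y = j then p else e.symm ⟨y, h⟩
  left_inv x := by
    by_cases h : x = p
    · simp [h]
    · have := (e ⟨x, h⟩).2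
      simp [h, this]
  right_inv y := by
    by_cases h : y = j
    · simp [h]
    · have := (e.symm ⟨y, h⟩).2
      simp [h, this]

variable {p j}

theorem extendAt_self (e : {x // x ≠ p} ≃ {y // y ≠ j}) : extendAt p j e p = j := by
  simp [extendAt]

theorem extendAt_coe (e : {x // x ≠ p} ≃ {y // y ≠ j}) (x : {x // x ≠ p}) :
    extendAt p j e x = e x := by
  simp [extendAt, x.2]

theorem extendAt_injective : Function.Injective (extendAt p j) := by
  intro e e' h
  ext x
  rw [← extendAt_coe, ← extendAt_coe, h]

theorem exists_extendAt_eq (a : α ≃ β) (h : a p = j) : ∃ e, extendAt p j e = a := by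
  refine ⟨a.subtypeEquiv fun x => ?_, ?_⟩
  · rw [← h, a.injective.ne_iff]
  · ext x
    by_cases hx : x = p
    · rw [hx, extendAt_self, h]
    · exact extendAt_coe _ ⟨x, hx⟩

theorem ncard_extendAt_agree [Finite α] (e e' : {x // x ≠ p} ≃ {y // y ≠ j}) :
    {x | extendAt p j e x = extendAt p j e' x}.ncard = {x | e x = e' x}.ncard + 1 := by
  have : {x | extendAt p j e x = extendAt p j e' x} = insert p (Subtype.val '' {x | e x = e' x}) := by
    ext x
    by_cases hx : x = p
    · simp [hx, extendAt_self]
    · have h := extendAt_coe e ⟨x, hx⟩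
      have h' := extendAt_coe e' ⟨x, hx⟩
      simp only at h h'
      simp [hx, h, h', Subtype.ext_iff]
  rw [this, Set.ncard_insert_of_notMem (by simp),
    Set.ncard_image_of_injective _ Subtype.val_injective]

theorem agreeGraph_extendAt_adj [Finite α] {k : ℕ} {e e' : {x // x ≠ p} ≃ {y // y ≠ j}} :
    (agreeGraph α β (k + 1)).Adj (extendAt p j e) (extendAt p j e') ↔
      (agreeGraph _ _ k).Adj e e' := by
  rw [agreeGraph_adj, agreeGraph_adj, ncard_extendAt_agree, extendAt_injective.ne_iff,
    Nat.add_right_cancel_iff]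

end Extend

/-- The step from `k` to `k + 1` agreements: the bijections with a prescribed value at a point form
a copy of the smaller graph. -/
theorem agreeGraph_isPanIn_succ {α β : Type*} [Finite α] {k n : ℕ} (p : α)
    (hβ : Nat.card β = n + 1) (hk : k + 2 ≤ n) (hn : 3 ≤ n)
    (ih : ∀ j : β, (agreeGraph {x // x ≠ p} {y // y ≠ j} k).IsPanIn .univ .univ n.factorial)
    {u v : α ≃ β} (huv : (agreeGraph α β (k + 1)).Adj u v) (hp : u p = v p) {l : ℕ} (hl : 2 ≤ l)
    (hl' : l ≤ (n + 1).factorial) : (agreeGraph α β (k + 1)).HasPathIn .univ u v l := by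
  classical
  have : Finite β := Nat.finite_of_card_ne_zero (by omega)
  have := Fintype.ofFinite β
  let B : β → Set (α ≃ β) := fun j => {σ | σ p = j}
  have hpan : ∀ j, (agreeGraph α β (k + 1)).IsPanIn (B j) (B j) n.factorial := by
    intro j a ha b hb hab m hm hm'
    obtain ⟨a, rfl⟩ := exists_extendAt_eq a ha
    obtain ⟨b, rfl⟩ := exists_extendAt_eq b hb
    exact (ih j a trivial b trivial (agreeGraph_extendAt_adj.1 hab) m hm hm').map
      ⟨extendAt p j, fun h => agreeGraph_extendAt_adj.2 h⟩ extendAt_injective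
      fun e _ => extendAt_self e
  have hlink : ∀ i j, i ≠ j → (agreeGraph α β (k + 1)).IsLinked (B i) (B j) := by
    intro i j hij
    -- Composing with `x` on the value side preserves all agreements, and `σ` agrees with its image
    -- exactly where `σ` takes a fixed point of `x` as value.
    obtain ⟨x, hx, hxc⟩ := exists_perm_ncard_fixed (k := k + 1) hij (by omega)
    refine ⟨fun σ => σ.trans x, fun σ hσ => ⟨?_, ?_, ?_⟩, fun a _ b _ hab => ⟨?_, ?_⟩⟩
    · change x (σ p) = j
      rw [show σ p = i from hσ, hx]
    · intro h
      have := Equiv.congr_fun h p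
      rw [Equiv.trans_apply, show σ p = i from hσ, hx] at this
      exact hij this
    · have : {y | σ y = (σ.trans x) y} = σ ⁻¹' {y | x y = y} := by
        ext y
        simp [eq_comm]
      rw [this, ← Equiv.image_symm_eq_preimage,
        Set.ncard_image_of_injective _ (Equiv.injective _), hxc]
    · intro h
      exact hab.1 (Equiv.ext fun y => x.injective (Equiv.congr_fun h y))
    · simpa using hab.2
  -- Any two distinct fibres are linked, so every ordering gives a chain.
  let L := ((Finset.univ : Finset β).erase (u p)).toList
  have hnd : (u p :: L).Nodup := by
    simp [L, Finset.nodup_toList]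
  have hlen : (u p :: L).length = n + 1 := by
    rw [List.length_cons, Finset.length_toList, Finset.card_erase_of_mem (Finset.mem_univ _),
      Finset.card_univ, ← Nat.card_eq_fintype_card, hβ]
    rfl
  have h6 : 3 ≤ n.factorial := hn.trans (Nat.self_le_factorial n)
  have key := SimpleGraph.IsPanIn.chain (G := agreeGraph α β (k + 1)) (B := B) h6 (u p) L
    (fun j _ => hpan j) ?_ hnd ?_
  · rw [hlen, mul_comm, ← Nat.factorial_succ] at key
    exact (key u rfl v hp.symm huv l hl hl').mono (Set.subset_univ _)
  · intro j _ j' _ hjj'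
    rw [Set.disjoint_left]
    rintro σ rfl h
    exact hjj' h
  · exact (List.Pairwise.imp (fun h => hlink _ _ h) hnd).isChain

/-! ### Common neighbours and covering chains -/

/-- Any two bijections between types with at least four elements are avoided by a third. -/
theorem exists_equiv_forall_ne_ne {α β : Type*} [Finite α] (hα : 4 ≤ Nat.card α) (u v : α ≃ β) :
    ∃ w : α ≃ β, ∀ x, w x ≠ u x ∧ w x ≠ v x := by
  classical
  have := Fintype.ofFinite α
  have := Fintype.ofEquiv α u
  rw [Nat.card_eq_fintype_card] at hα
  have hcard := Fintype.card_congr u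
  obtain ⟨f, hf, hft⟩ := (Finset.all_card_le_biUnion_card_iff_exists_injective
    fun x => ({u x, v x} : Finset β)ᶜ).1 fun s => by
      rcases s.eq_empty_or_nonempty with rfl | ⟨x, hx⟩
      · simp
      by_cases hs : s.card ≤ 2
      · refine le_trans ?_ (Finset.card_le_card (Finset.subset_biUnion_of_mem _ hx))
        rw [Finset.card_compl]
        have := Finset.card_le_two (a := u x) (b := v x)
        omega
      -- Hall's condition: a value `y` is forbidden only at `u.symm y` and `v.symm y`, hence allowed
      -- somewhere on a set of three or more points.
      · have : (s.biUnion fun x => ({u x, v x} : Finset β)ᶜ) = Finset.univ := by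
          refine Finset.eq_univ_iff_forall.2 fun y => ?_
          obtain ⟨z, hz, hz'⟩ := Finset.exists_mem_notMem_of_card_lt_card
            (s := {u.symm y, v.symm y}) (t := s)
            (lt_of_le_of_lt Finset.card_le_two (not_le.1 hs))
          refine Finset.mem_biUnion.2 ⟨z, hz, ?_⟩
          simpa [Equiv.eq_symm_apply, eq_comm] using hz'
        rw [this, Finset.card_univ, ← hcard]
        exact Finset.card_le_univ s
  refine ⟨Equiv.ofBijective f ((Fintype.bijective_iff_injective_and_card f).2 ⟨hf, hcard⟩),
    fun x => ?_⟩
  simpa using hft x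

/-- If `τ` is a fixed-point-free involution along `R` and each `x` is related to at least one member
of each pair `{y, τ y}`, then every `τ`-closed finite set has a spanning `R`-chain from each of its
members. -/
theorem exists_isChain_cover {ι : Type*} [DecidableEq ι] {R : ι → ι → Prop} {τ : ι → ι}
    (hτ : ∀ x, τ (τ x) = x) (hne : ∀ x, τ x ≠ x) (hR : ∀ x, R x (τ x))
    (hR' : ∀ x y, R x y ∨ R x (τ y)) (S : Finset ι) (hS : ∀ x ∈ S, τ x ∈ S) (g : ι) (hg : g ∈ S) :
    ∃ L : List ι, (g :: L).Nodup ∧ (g :: L).IsChain R ∧ ∀ x, x ∈ g :: L ↔ x ∈ S := by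
  induction S using Finset.strongInduction generalizing g with
  | H S ih =>
    have hτg := hS g hg
    let S' := (S.erase g).erase (τ g)
    have hmem : ∀ x, x ∈ S' ↔ x ≠ τ g ∧ x ≠ g ∧ x ∈ S := fun x => by simp [S']
    have hS' : ∀ x ∈ S', τ x ∈ S' := by
      intro x hx
      rw [hmem] at hx ⊢
      refine ⟨fun h => hx.2.1 ?_, fun h => hx.1 ?_, hS x hx.2.2⟩
      · rw [← hτ x, h, hτ]
      · rw [← hτ x, h]
    rcases S'.eq_empty_or_nonempty with he | ⟨y, hy⟩
    · refine ⟨[τ g], by simpa using (hne g).symm, by simpa using hR g, fun x => ?_⟩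
      have := hmem x
      rw [he] at this
      simp only [Finset.notMem_empty, false_iff] at this
      simp only [List.mem_cons, List.not_mem_nil, or_false]
      refine ⟨?_, fun h => by tauto⟩
      rintro (rfl | rfl) <;> assumption
    -- After `g, τ g`, the chain enters a remaining pair by whichever member is related to `τ g`.
    · obtain ⟨z, hz, hgz⟩ : ∃ z ∈ S', R (τ g) z := by
        rcases hR' (τ g) y with h | h
        · exact ⟨y, hy, h⟩
        · exact ⟨τ y, hS' y hy, h⟩
      have hss : S' ⊂ S := by
        refine Finset.ssubset_iff_subset_ne.2 ⟨fun x hx => ((hmem x).1 hx).2.2, fun h => ?_⟩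
        rw [← h] at hg
        exact ((hmem g).1 hg).2.1 rfl
      obtain ⟨L, hnd, hc, hL⟩ := ih S' hss hS' z hz
      refine ⟨τ g :: z :: L, ?_, ?_, fun x => ?_⟩
      · rw [List.nodup_cons, List.nodup_cons, List.mem_cons, hL, hL, hmem, hmem]
        exact ⟨by simpa using (hne g).symm, by simp, hnd⟩
      · exact List.isChain_cons_cons.2 ⟨hR g, List.isChain_cons_cons.2 ⟨hgz, hc⟩⟩
      · rw [List.mem_cons, List.mem_cons, hL, hmem]
        constructor
        · rintro (rfl | rfl | h)
          exacts [hg, hτg, h.2.2]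
        · tauto

/-! ### Derangements: blocks of translates -/

section Translates

variable {α β : Type*} [AddCommGroup α]

/-- The bijections obtained from `g` by translating the argument. -/
def translates (g : α ≃ β) : Set (α ≃ β) :=
  Set.range fun i : α => (Equiv.addRight i).trans g

/-- Some translate of `g'` agrees with `g` nowhere. -/
def HasAvoidingTranslate (g g' : α ≃ β) : Prop :=
  ∃ d, ∀ x, g x ≠ g' (x + d)

theorem translate_mem_translates {g σ : α ≃ β} (h : σ ∈ translates g) (i : α) :
    (Equiv.addRight i).trans σ ∈ translates g := by
  obtain ⟨j, rfl⟩ := h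
  exact ⟨i + j, by ext; simp [add_assoc]⟩

/-- Normalising by `g 0 = b` selects one representative in each class, so these `g` index the
blocks. -/
theorem exists_mem_translates (b : β) (σ : α ≃ β) :
    ∃ g : {g : α ≃ β // g 0 = b}, σ ∈ translates g.1 :=
  ⟨⟨(Equiv.addRight (σ.symm b)).trans σ, by simp⟩, -σ.symm b, by ext; simp⟩

theorem disjoint_translates {b : β} {g g' : {g : α ≃ β // g 0 = b}} (h : g ≠ g') :
    Disjoint (translates g.1) (translates g'.1) := by
  rw [Set.disjoint_left]
  rintro _ ⟨i, rfl⟩ ⟨j, hj⟩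
  have hj : ∀ x, g'.1 (x + j) = g.1 (x + i) := fun x => Equiv.congr_fun hj x
  have hij : -i + j = 0 := by
    apply g'.1.injective
    rw [hj, neg_add_cancel, g.2, g'.2]
  rw [neg_add_eq_zero] at hij
  subst hij
  refine h (Subtype.ext (Equiv.ext fun x => ?_))
  simpa using (hj (x - i)).symm

theorem ncard_translates (g : α ≃ β) : (translates g).ncard = Nat.card α := by
  rw [translates, Set.ncard_range_of_injective]
  intro i j h
  have := Equiv.congr_fun h 0
  simpa using this

variable [Finite α]

theorem finite_translates (g : α ≃ β) : (translates g).Finite := Set.finite_range _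

theorem adj_translate {σ : α ≃ β} {i : α} (hi : i ≠ 0) :
    (agreeGraph α β 0).Adj σ ((Equiv.addRight i).trans σ) := by
  rw [agreeGraph_zero_adj]
  intro x
  simpa using hi

theorem isClique_translates (g : α ≃ β) : (agreeGraph α β 0).IsClique (translates g) := by
  rintro _ ⟨i, rfl⟩ _ ⟨j, rfl⟩ hij
  rw [agreeGraph_zero_adj]
  intro x h
  apply hij
  have : i = j := by simpa using h
  rw [this]

theorem isPanIn_translates (g : α ≃ β) :
    (agreeGraph α β 0).IsPanIn (translates g) (translates g) (Nat.card α) := by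
  have := SimpleGraph.isPanIn_of_isClique (finite_translates g) (isClique_translates g)
  rwa [ncard_translates] at this

/-- The link translates the argument by `d` and carries values along `g' ∘ g⁻¹`; both operations are
bijective, so they preserve having no agreement. -/
theorem HasAvoidingTranslate.isLinked {g g' : α ≃ β} (h : HasAvoidingTranslate g g') :
    (agreeGraph α β 0).IsLinked (translates g) (translates g') := by
  obtain ⟨d, hd⟩ := h
  refine ⟨fun σ => (Equiv.addRight d).trans (σ.trans (g.symm.trans g')), ?_, ?_⟩
  · rintro _ ⟨i, rfl⟩
    refine ⟨⟨d + i, by ext; simp [add_assoc]⟩, agreeGraph_zero_adj.2 fun x => ?_⟩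
    simpa [add_right_comm] using hd (x + i)
  · intro a _ b _ hab
    rw [agreeGraph_zero_adj] at hab ⊢
    intro x
    simpa using hab (x + d)

theorem card_equiv_fixing (b : β) (e : α ≃ β) :
    Nat.card {g : α ≃ β // g 0 = b} * Nat.card α = (Nat.card α).factorial := by
  classical
  have := Fintype.ofFinite α
  have := Fintype.ofEquiv α e
  have hcard : Nat.card (α ≃ β) = (Nat.card α).factorial := by
    rw [Nat.card_eq_fintype_card, Nat.card_eq_fintype_card, Fintype.card_equiv e]
  rw [← hcard, ← Nat.card_prod]
  refine Nat.card_congr (Equiv.ofBijective (fun x => (Equiv.addRight x.2).trans x.1.1) ⟨?_, ?_⟩)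
  · rintro ⟨g, i⟩ ⟨g', j⟩ h
    have hg : g = g' := by
      by_contra hne
      exact Set.disjoint_left.1 (disjoint_translates hne) ⟨i, rfl⟩ ⟨j, h.symm⟩
    subst hg
    have := Equiv.congr_fun h 0
    simp only [Equiv.trans_apply, Equiv.coe_addRight, zero_add, EmbeddingLike.apply_eq_iff_eq]
      at this
    rw [this]
  · intro σ
    obtain ⟨g, i, h⟩ := exists_mem_translates b σ
    exact ⟨(g, i), h⟩

variable [DecidableEq α]

/-- The transposition displaces points only by `0` or `±(q - p)`; with four elements another
displacement `d` exists. -/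
theorem hasAvoidingTranslate_swap (hα : 4 ≤ Nat.card α) (g : α ≃ β) (p q : α) :
    HasAvoidingTranslate g ((Equiv.swap p q).trans g) := by
  have := Fintype.ofFinite α
  obtain ⟨d, -, hd⟩ := Finset.exists_mem_notMem_of_card_lt_card (s := {0, q - p, p - q})
    (t := (Finset.univ : Finset α)) (by
      rw [Finset.card_univ, ← Nat.card_eq_fintype_card]
      exact lt_of_le_of_lt Finset.card_le_three hα)
  simp only [Finset.mem_insert, Finset.mem_singleton, not_or] at hd
  refine ⟨d, fun x hx => ?_⟩
  have hx : x = Equiv.swap p q (x + d) := g.injective hx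
  rw [Equiv.swap_apply_def] at hx
  split_ifs at hx with h h'
  · exact hd.2.2 (by rw [← h, hx]; abel)
  · exact hd.2.1 (by rw [← h', hx]; abel)
  · exact hd.1 (by simpa using hx)

/-- If every translate of `g'` meets `g`, then `x ↦ g'⁻¹ (g x) - x` is a bijection, and a
transposition destroys this property. -/
theorem hasAvoidingTranslate_or_swap (g g' : α ≃ β) {p q : α} (hpq : p ≠ q) :
    HasAvoidingTranslate g g' ∨ HasAvoidingTranslate g ((Equiv.swap p q).trans g') := by
  by_contra! hcon
  obtain ⟨h₁, h₂⟩ := hcon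
  simp only [HasAvoidingTranslate, not_exists, not_forall, not_not] at h₁ h₂
  let h : α ≃ α := g.trans g'.symm
  have hs : Function.Surjective fun x => h x - x := by
    intro d
    obtain ⟨x, hx⟩ := h₁ d
    exact ⟨x, by simp [h, hx]⟩
  have hi := Finite.injective_iff_surjective.2 hs
  -- With `r = h.symm p`, injectivity makes `r` the only point where `h x - x` equals `p - r`. The
  -- transposition changes `h r`, and no other point can acquire this difference.
  obtain ⟨z, hz⟩ := h₂ (h (h.symm p) - h.symm p)
  have hz : Equiv.swap p q (h z) = z + (p - h.symm p) := by
    have : h z = Equiv.swap p q (z + (p - h.symm p)) := by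
      simp [h, hz]
    rw [this, Equiv.swap_apply_self]
  rw [Equiv.swap_apply_def] at hz
  split_ifs at hz with hp hq
  · rw [← hp, Equiv.symm_apply_apply, hp] at hz
    apply hpq
    rw [hz]
    abel
  · have : z = h.symm p := by
      have e : z - h.symm p = 0 := by
        have : p = p + (z - h.symm p) := by
          conv_lhs => rw [hz]
          abel
        simpa using this
      exact sub_eq_zero.1 e
    rw [this, Equiv.apply_symm_apply] at hq
    exact hpq hq
  · apply hp
    have : z = h.symm p := hi (by
      change h z - z = h (h.symm p) - h.symm p
      rw [hz, Equiv.apply_symm_apply]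
      abel)
    rw [this, Equiv.apply_symm_apply]

/-- Composition with a transposition that fixes `0`. -/
def swapAt {b : β} {p q : α} (hp : p ≠ 0) (hq : q ≠ 0) (g : {g : α ≃ β // g 0 = b}) :
    {g : α ≃ β // g 0 = b} :=
  ⟨(Equiv.swap p q).trans g.1, by
    rw [Equiv.trans_apply, Equiv.swap_apply_of_ne_of_ne hp.symm hq.symm, g.2]⟩

/-- This lets the pair of `g` avoid `g'`, so that two different blocks can be put on opposite sides
of a split into paired sets. -/
theorem exists_swap_trans_ne (hα : 4 ≤ Nat.card α) (g g' : α ≃ β) :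
    ∃ p q : α, p ≠ 0 ∧ q ≠ 0 ∧ p ≠ q ∧ (Equiv.swap p q).trans g ≠ g' := by
  have := Fintype.ofFinite α
  have hc : 2 < (Finset.univ.erase (0 : α)).card := by
    rw [Finset.card_erase_of_mem (Finset.mem_univ _), Finset.card_univ,
      ← Nat.card_eq_fintype_card]
    omega
  obtain ⟨p, q, r, hp, hq, hr, hpq, hpr, hqr⟩ := Finset.two_lt_card_iff.1 hc
  simp only [Finset.mem_erase, Finset.mem_univ, and_true] at hp hq hr
  by_cases h : (Equiv.swap p q).trans g = g'
  · refine ⟨p, r, hp, hr, hpr, ?_⟩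
    rintro rfl
    have := Equiv.congr_fun h p
    simp at this
    exact hqr this
  · exact ⟨p, q, hp, hq, hpq, h⟩

/-- The unions of blocks of translates over a set closed under a transposition. -/
theorem isPanIn_biUnion_translates {b : β} (hα : 4 ≤ Nat.card α) {p q : α} (hp : p ≠ 0)
    (hq : q ≠ 0) (hpq : p ≠ q) (S : Finset {g : α ≃ β // g 0 = b})
    (hS : ∀ g ∈ S, swapAt hp hq g ∈ S) (g : {g : α ≃ β // g 0 = b}) (hg : g ∈ S) :
    (agreeGraph α β 0).IsPanIn (translates g.1) {σ | ∃ g ∈ S, σ ∈ translates g.1}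
      (Nat.card α * S.card) := by
  classical
  obtain ⟨L, hnd, hc, hL⟩ := exists_isChain_cover
    (R := fun g g' : {g : α ≃ β // g 0 = b} => HasAvoidingTranslate g.1 g'.1)
    (τ := swapAt hp hq)
    (fun x => Subtype.ext (Equiv.ext fun y => by simp [swapAt]))
    (fun x h => hpq (by
      have := Equiv.congr_fun (congrArg Subtype.val h) q
      simpa [swapAt] using this))
    (fun x => hasAvoidingTranslate_swap hα x.1 p q)
    (fun x y => hasAvoidingTranslate_or_swap x.1 y.1 hpq) S hS g hg
  have hlen : (g :: L).length = S.card := by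
    rw [← List.toFinset_card_of_nodup hnd]
    congr 1
    ext x
    rw [List.mem_toFinset, hL]
  have := SimpleGraph.IsPanIn.chain (G := agreeGraph α β 0)
    (B := fun g : {g : α ≃ β // g 0 = b} => translates g.1) (by omega) g L
    (fun j _ => isPanIn_translates j.1) (fun _ _ _ _ h => disjoint_translates h) hnd
    (hc.imp fun _ _ h => h.isLinked)
  simpa only [hlen, hL] using this

/-- Ends in one block are handled by a chain through all blocks. Otherwise the blocks are split into
`S`, the pair of `g`, and its complement, and a path from each side is joined by a translate of the
edge `uv`. -/
theorem agreeGraph_zero_hasPathIn (hα : 4 ≤ Nat.card α) {u v : α ≃ β}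
    (huv : (agreeGraph α β 0).Adj u v) {l : ℕ} (hl : 2 ≤ l) (hl' : l ≤ (Nat.card α).factorial) :
    (agreeGraph α β 0).HasPathIn .univ u v l := by
  classical
  have : Finite β := Finite.of_equiv α u
  have : Finite (α ≃ β) := inferInstance
  have := Fintype.ofFinite {g : α ≃ β // g 0 = u 0}
  have hcard := card_equiv_fixing (u 0) u
  rw [Nat.card_eq_fintype_card (α := {g : α ≃ β // g 0 = u 0}), mul_comm] at hcard
  obtain ⟨g, hg⟩ := exists_mem_translates (u 0) u
  obtain ⟨g', hg'⟩ := exists_mem_translates (u 0) v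
  obtain ⟨p, q, hp, hq, hpq, hne⟩ := exists_swap_trans_ne hα g.1 g'.1
  by_cases hgg : g = g'
  · subst hgg
    have h := isPanIn_biUnion_translates hα hp hq hpq Finset.univ (by simp) g (Finset.mem_univ _)
    rw [Finset.card_univ, hcard] at h
    exact (h u hg v hg' huv l hl hl').mono (Set.subset_univ _)
  have hne' : swapAt hp hq g ≠ g' := fun h => hne (congrArg Subtype.val h)
  have hsw : ∀ x : {g : α ≃ β // g 0 = u 0}, swapAt hp hq (swapAt hp hq x) = x :=
    fun x => Subtype.ext (Equiv.ext fun y => by simp [swapAt])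
  have hne₀ : g ≠ swapAt hp hq g := fun h => hpq (by
    have := Equiv.congr_fun (congrArg Subtype.val h) q
    simpa [swapAt, eq_comm] using this)
  let S : Finset {g : α ≃ β // g 0 = u 0} := {g, swapAt hp hq g}
  have hS : ∀ x ∈ S, swapAt hp hq x ∈ S := by
    intro x hx
    simp only [S, Finset.mem_insert, Finset.mem_singleton] at hx ⊢
    rcases hx with rfl | rfl
    · exact .inr rfl
    · exact .inl (hsw g)
  have hS' : ∀ x ∈ Sᶜ, swapAt hp hq x ∈ Sᶜ := by
    intro x hx
    rw [Finset.mem_compl] at hx ⊢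
    intro h
    exact hx (hsw x ▸ hS _ h)
  have hSc : S.card = 2 := Finset.card_pair hne₀
  have hgS' : g' ∈ Sᶜ := by
    simp only [S, Finset.mem_compl, Finset.mem_insert, Finset.mem_singleton, not_or]
    exact ⟨Ne.symm hgg, hne'.symm⟩
  have hpos : 0 < Sᶜ.card := Finset.card_pos.2 ⟨g', hgS'⟩
  have h₁ := isPanIn_biUnion_translates hα hp hq hpq S hS g (by simp [S])
  have h₂ := isPanIn_biUnion_translates hα hp hq hpq Sᶜ hS' g' hgS'
  have hsum : Nat.card α * S.card + Nat.card α * Sᶜ.card = (Nat.card α).factorial := by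
    rw [← mul_add, Finset.card_add_card_compl, hcard]
  have hN₁ : 4 ≤ Nat.card α * S.card := by rw [hSc]; omega
  have hN₂ : 4 ≤ Nat.card α * Sᶜ.card := by nlinarith
  rcases (show l = 2 ∨ l = 3 ∨ 4 ≤ l by omega) with rfl | rfl | hl4
  · exact .of_adj huv trivial trivial
  -- Three vertices cannot be split into two paths on at least two vertices each, so a common
  -- neighbour is needed.
  · obtain ⟨w, hw⟩ := exists_equiv_forall_ne_ne hα u v
    have huw : (agreeGraph α β 0).Adj u w := agreeGraph_zero_adj.2 fun x => (hw x).1.symm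
    have hwv : (agreeGraph α β 0).Adj w v := agreeGraph_zero_adj.2 fun x => (hw x).2
    refine ((SimpleGraph.HasPathIn.single u).append huw
      (SimpleGraph.HasPathIn.of_adj (T := {w, v}) hwv (by simp) (by simp)) ?_).mono
      (Set.subset_univ _)
    simp [huw.ne, huv.ne]
  · obtain ⟨m, m', rfl, hm, hmN, hm', hmN'⟩ : ∃ m m', l = m + m' ∧ 2 ≤ m ∧
        m ≤ Nat.card α * S.card ∧ 2 ≤ m' ∧ m' ≤ Nat.card α * Sᶜ.card := by
      by_cases h : l - 2 ≤ Nat.card α * Sᶜ.card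
      · exact ⟨2, l - 2, by omega, le_rfl, by omega, by omega, h⟩
      · exact ⟨l - Nat.card α * Sᶜ.card, Nat.card α * Sᶜ.card, by omega, by omega, by omega,
          by omega, le_rfl⟩
    -- Here `p` serves only as a nonzero translation.
    have e₁ := h₁ u hg _ (translate_mem_translates hg p) (adj_translate hp) m hm hmN
    have e₂ := (h₂ v hg' _ (translate_mem_translates hg' p) (adj_translate hp) m' hm' hmN').symm
    refine (e₁.append ?_ e₂ ?_).mono (Set.subset_univ _)
    · rw [agreeGraph_zero_adj] at huv ⊢
      exact fun x => huv (x + p)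
    · rw [Set.disjoint_left]
      rintro σ ⟨x, hx, hσ⟩ ⟨y, hy, hσ'⟩
      refine Set.disjoint_left.1 (disjoint_translates ?_) hσ hσ'
      rintro rfl
      exact Finset.mem_compl.1 hy hx

end Translates

/-! ### Induction on the number of agreements and conclusion -/

theorem agreeGraph_isPanIn (k : ℕ) : ∀ (α β : Type) (n : ℕ), Nat.card α = n → Nat.card β = n →
    k + 4 ≤ n → (agreeGraph α β k).IsPanIn .univ .univ n.factorial := by
  induction k with
  | zero =>
    rintro α β _ rfl - hn u - v - huv l hl hl'
    classical
    have : Finite α := Nat.finite_of_card_ne_zero (by omega)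
    have : NeZero (Nat.card α) := ⟨by omega⟩
    -- Any abelian group structure would do; this one is cyclic.
    let _ : AddCommGroup α := (Finite.equivFin α).addCommGroup
    exact agreeGraph_zero_hasPathIn (by omega) huv hl hl'
  | succ k ih =>
    intro α β n hα hβ hn u _ v _ huv l hl hl'
    have : Finite α := Nat.finite_of_card_ne_zero (by omega)
    have : Finite β := Nat.finite_of_card_ne_zero (by omega)
    obtain ⟨n, rfl⟩ : ∃ m, n = m + 1 := ⟨n - 1, by omega⟩
    obtain ⟨p, hp⟩ : {x | u x = v x}.Nonempty := by
      rw [← Set.ncard_pos, huv.2]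
      omega
    have hcard : ∀ (γ : Type) (c : γ), Nat.card γ = n + 1 → Nat.card {x // x ≠ c} = n := by
      intro γ c hγ
      have : Finite γ := Nat.finite_of_card_ne_zero (by omega)
      have h := Set.ncard_sdiff_singleton_of_mem (Set.mem_univ c)
      rw [Set.ncard_univ, hγ, Nat.add_sub_cancel] at h
      rw [← Set.coe_ofPred, Nat.card_coe_set_eq]
      convert h using 2
      ext
      simp
    exact agreeGraph_isPanIn_succ p hβ (by omega) (by omega)
      (fun j => ih _ _ n (hcard α p hα) (hcard β j hβ) (by omega)) huv hp hl hl'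

theorem theorem1p3 (k n : ℕ) (hk : 2 * k + 1 ≤ n) (hn : 4 ≤ n)
    (h41 : ¬ (n = 4 ∧ k = 1)) (h52 : ¬ (n = 5 ∧ k = 2)) :
    (fixedPointGraph n k).IsEdgePancyclic := by
  have hkn : k + 4 ≤ n := by omega
  have hG : fixedPointGraph n k = agreeGraph (Fin n) (Fin n) k := by
    ext u v
    rw [fixedPointGraph_adj (by omega), agreeGraph_adj, Set.ncard_eq_toFinset_card',
      Set.toFinset_ofPred]
    refine ⟨fun h => ⟨?_, h⟩, fun h => h.2⟩
    rintro rfl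
    simp at h
    omega
  have hcard : Fintype.card (Equiv.Perm (Fin n)) = n.factorial := by
    rw [Fintype.card_perm, Fintype.card_fin]
  rw [hG]
  refine ⟨?_, ?_⟩
  · rw [hcard]
    exact (show 3 ≤ n by omega).trans (Nat.self_le_factorial n)
  · intro e he l hl hl'
    induction e with
    | h u v =>
      rw [hcard] at hl'
      have h := agreeGraph_isPanIn k (Fin n) (Fin n) n (by simp) (by simp) hkn u trivial v trivial
        he l (by omega) hl'
      exact ⟨v, h.exists_isCycle he hl⟩
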